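/- **Definitions.** Circuits are Boolean circuits of unbounded fan-in (gates $\wedge,\vee,\neg$, variables, constants) with one output; the size is the number of gates and the depth is the length of a longest directed path. A parameterized promise problem consists of a set of yes-instances and a set of no-instances in $\{0,1\}^*$ and a parameterization $\kappa:\{0,1\}^*\to\mathbb N$; a parameterized problem $(Q,\kappa)$ is the case where every string outside $Q$ is a no-instance. Such a problem is in *para-$\mathrm{AC}^0$* if there is a family $(C_{n,k})_{n,k\in\mathbb N}$ of circuits, $C_{n,k}$ having $n$ input variables, such that (1) the depth of all $C_{n,k}$ is bounded by a constant; (2) $|C_{n,k}|\le f(k)\cdot (n+1)^{c}$ for a computable $f:\mathbb N\to\mathbb N$ and a constant $c$; (3) $C_{|x|,\kappa(x)}(x)=1$ for every yes-instance $x$, and $C_{|x|,\kappa(x)}(x)=0$ for every no-instance $x$; (4) some deterministic Turing machine computes $C_{n,k}$ from $(1^n,1^k)$ in time $g(k)+O(\log n)$ for a computable $g:\mathbb N\to\mathbb N$, in the sense that, with random access to its input words, it decides within this time whether the $i$th bit of the binary encoding of $C_{n,k}$ is $b$, given $(b,i,1^n,1^k)$. It is in *nonuniform para-$\mathrm{AC}^0$*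 if there is a family satisfying (1), (3) and (2) with an arbitrary, not necessarily computable, $f:\mathbb N\to\mathbb N$. For a finite graph $G$ let $\omega(G)$ be its clique number. Pairs $(G,k)$ of a finite graph and a number $k\in\mathbb N$ are encoded as binary strings by the digits of $k$ and the adjacency matrix of $G$, and have parameter $k$. The problem $p\text{-Clique}$ asks, given $(G,k)$, whether $G$ contains a clique of size $k$. For $\rho:\mathbb N\to\mathbb R_{\ge 1}$ the promise problem $p\text{-Gap-Clique}_\rho$ has as yes-instances the pairs $(G,k)$ with $k\le \omega(G)/\rho(\omega(G))$ and as no-instances the pairs $(G,k)$ with $k>\omega(G)$. A *cost approximation for $p\text{-Clique}$ of ratio $\rho$* is a decision procedure that accepts all these yes-instances and rejects all these no-instances; it is computable in (nonuniform) para-$\mathrm{AC}^0$ if the set of strings that it accepts, parameterized by $k$, is in (nonuniform) para-$\mathrm{AC}^0$. **Theorem.** Let $\rho:\mathbb N\to\mathbb R_{\ge 1}$ be a computable function such that the mapping $k\mapsto k/\rho(k)$ is nondecreasing and unbounded. Then $$p\text{-Gap-Clique}_\rho\notin\text{para-}\mathrm{AC}^0,$$ and $p\text{-Clique}$ has no cost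 approximation of ratio $\rho$ computable in para-$\mathrm{AC}^0$. Both statements also hold with nonuniform para-$\mathrm{AC}^0$ in place of para-$\mathrm{AC}^0$. Moreover, $p\text{-Clique}\notin\text{para-}\mathrm{AC}^0$, and $p\text{-Clique}$ is not in nonuniform para-$\mathrm{AC}^0$ either. -/

import Mathlib

namespace ParaAC

/-! ### Boolean circuits of unbounded fan-in -/

/-- Labels of the gates of a circuit on the input variables `0, …, n - 1`. -/
inductive GateLabel (n : ℕ) : Type
  | and : GateLabel n
  | or : GateLabel n
  | not : GateLabel n
  | var (i : Fin n) : GateLabel n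
  | const (b : Bool) : GateLabel n

/-- The number of ingoing wires that a gate with a given label may have:
arbitrarily many for conjunctions and disjunctions, one for negations, none for
variables and constants. -/
def GateLabel.FanInOk {n : ℕ} : GateLabel n → ℕ → Prop
  | .and, _ => True
  | .or, _ => True
  | .not, m => m = 1
  | .var _, m => m = 0
  | .const _, m => m = 0

/-- A circuit with `n` input variables and one output: a finite directed acyclic graph
whose nodes (gates) carry labels. `inputs g` is the set of gates with a wire into `g`. -/
structure Circuit (n : ℕ) : Type where
  /-- the number of gates -/
  size : ℕ
  label : Fin size → GateLabel n
  inputs : Fin size → Finset (Fin size)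
  fanIn : ∀ g, (label g).FanInOk (inputs g).card
  acyclic : WellFounded (fun h g : Fin size => h ∈ inputs g)
  output : Fin size

namespace Circuit

variable {n : ℕ}

/-- The truth value computed at gate `g` on the input `x`. -/
def value (C : Circuit n) (x : Fin n → Bool) : Fin C.size → Bool :=
  C.acyclic.fix fun g val =>
    match C.label g with
    | .and => decide (∀ h, ∀ hh : h ∈ C.inputs g, val h hh = true)
    | .or => decide (∃ h, ∃ hh : h ∈ C.inputs g, val h hh = true)
    | .not => decide (∀ h, ∀ hh : h ∈ C.inputs g, val h hh = false)
    | .var i => x i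
    | .const b => b

theorem value_eq (C : Circuit n) (x : Fin n → Bool) (g : Fin C.size) :
    C.value x g =
      match C.label g with
      | .and => decide (∀ h ∈ C.inputs g, C.value x h = true)
      | .or => decide (∃ h ∈ C.inputs g, C.value x h = true)
      | .not => decide (∀ h ∈ C.inputs g, C.value x h = false)
      | .var i => x i
      | .const b => b := by
  have h := C.acyclic.fix_eq (C := fun _ => Bool) (fun g val =>
    match C.label g with
    | .and => decide (∀ h, ∀ hh : h ∈ C.inputs g, val h hh = true)
    | .or => decide (∃ h, ∃ hh : h ∈ C.inputs g, val h hh = true)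
    | .not => decide (∀ h, ∀ hh : h ∈ C.inputs g, val h hh = false)
    | .var i => x i
    | .const b => b) g
  unfold value
  rw [h]
  cases C.label g <;> simp

/-- The Boolean function computed by the circuit. -/
def eval (C : Circuit n) (x : Fin n → Bool) : Bool := C.value x C.output

/-- The length of a longest directed path ending in gate `g`. -/
def gateDepth (C : Circuit n) : Fin C.size → ℕ :=
  C.acyclic.fix fun g dep => (C.inputs g).attach.sup fun h => dep h.1 h.2 + 1

theorem gateDepth_eq (C : Circuit n) (g : Fin C.size) :
    C.gateDepth g = (C.inputs g).sup fun h => C.gateDepth h + 1 := by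
  have h := C.acyclic.fix_eq (C := fun _ => ℕ)
    (fun g dep => (C.inputs g).attach.sup fun h => dep h.1 h.2 + 1) g
  unfold gateDepth
  rw [h]
  exact Finset.sup_attach (C.inputs g)
    (fun h => C.acyclic.fix (C := fun _ => ℕ)
      (fun g dep => (C.inputs g).attach.sup fun h => dep h.1 h.2 + 1) h + 1)

/-- The length of a longest directed path in the circuit. -/
def depth (C : Circuit n) : ℕ := Finset.univ.sup C.gateDepth

open Classical in
/-- The entry of the gate table of `C` for the (numbers of) gates `g` and `h` and the
field `j < 8`. Field `0` says whether there is a wire from `h` into `g`, field `1` whether `g`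
is the output gate, fields `2` to `6` whether `g` is a conjunction, disjunction, negation,
constant true, constant false, and field `7` whether `g` is labelled by the variable `h`. -/
noncomputable def tableEntry (C : Circuit n) (g h j : ℕ) : Bool :=
  decide (∃ hg : g < C.size,
    match j with
    | 0 => ∃ hh : h < C.size, (⟨h, hh⟩ : Fin C.size) ∈ C.inputs ⟨g, hg⟩
    | 1 => C.output = ⟨g, hg⟩
    | 2 => C.label ⟨g, hg⟩ = .and
    | 3 => C.label ⟨g, hg⟩ = .or
    | 4 => C.label ⟨g, hg⟩ = .not
    | 5 => C.label ⟨g, hg⟩ = .const true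
    | 6 => C.label ⟨g, hg⟩ = .const false
    | _ => ∃ hh : h < n, C.label ⟨g, hg⟩ = .var ⟨h, hh⟩)

/-- The least `w` such that `w` bits suffice to number all gates and all variables. -/
def width (C : Circuit n) : ℕ := Nat.clog 2 (max C.size n)

/-- The binary encoding of a circuit: its gate table, padded with zeros to `2 ^ w` rows and
`2 ^ w` columns with `w = C.width`. The entry for `g`, `h`, `j` is the bit in position
`g * (2 ^ w * 8) + h * 8 + j`. -/
noncomputable def code (C : Circuit n) : List Bool :=
  List.ofFn fun i : Fin (2 ^ C.width * (2 ^ C.width * 8)) =>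
    C.tableEntry (i / (2 ^ C.width * 8)) (i / 8 % 2 ^ C.width) (i % 8)

end Circuit

/-! ### Turing machines with random access to their input -/

/-- The number with binary digits `l`, least significant digit first. -/
def ofBits (l : List Bool) : ℕ := l.foldr Nat.bit 0

/-- A work tape, infinite to the right: the contents of an initial segment (all further cells
are blank, a blank cell is `none`) and the position of the head. -/
structure WorkTape : Type where
  cells : List (Option Bool)
  head : ℕ

/-- Head movements. -/
inductive Move : Type
  | left : Move
  | stay : Move
  | right : Move

namespace WorkTape

def read (T : WorkTape) : Option Bool := T.cells.getD T.head none

def write (T : WorkTape) (s : Option Bool) : WorkTape :=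
  ⟨(T.cells ++ List.replicate (T.head + 1 - T.cells.length) none).set T.head s, T.head⟩

def move (T : WorkTape) : Move → WorkTape
  | .left => ⟨T.cells, T.head - 1⟩
  | .stay => T
  | .right => ⟨T.cells, T.head + 1⟩

/-- The number whose binary digits stand, least significant first, in the cells before the
first blank cell. -/
def number (T : WorkTape) : ℕ :=
  ofBits ((T.cells.takeWhile Option.isSome).map fun s => s.getD false)

end WorkTape

/-- A deterministic Turing machine with random access to `r` read-only input words. Each input
word comes with an address tape, and there are `work` further work tapes. In every
step the machine sees, besides its state and the symbols under its heads, for each input word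
the letter whose position is the number on the corresponding address tape, or that
there is no such letter. A state `q` with `answer q = some b` is a halting state with the
answer `b`. -/
structure Machine (r : ℕ) : Type where
  work : ℕ
  states : ℕ
  start : Fin states
  answer : Fin states → Option Bool
  next : Fin states → (Fin r → Option Bool) → (Fin r ⊕ Fin work → Option Bool) →
    Fin states × (Fin r ⊕ Fin work → Option Bool × Move)

namespace Machine

variable {r : ℕ}

/-- A configuration: a state and the tapes (the address tapes first). -/
structure Config (M : Machine r) : Type where
  state : Fin M.states
  tape : Fin r ⊕ Fin M.work → WorkTape

/-- The initial configuration: all tapes are blank. -/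
def init (M : Machine r) : M.Config := ⟨M.start, fun _ => ⟨[], 0⟩⟩

/-- One computation step on the input words `x`; halting configurations do not change. -/
def step (M : Machine r) (x : Fin r → List Bool) (c : M.Config) : M.Config :=
  match M.answer c.state with
  | some _ => c
  | none =>
    let a := M.next c.state (fun j => (x j)[(c.tape (Sum.inl j)).number]?)
      (fun j => (c.tape j).read)
    ⟨a.1, fun j => ((c.tape j).write (a.2 j).1).move (a.2 j).2⟩

/-- On the input words `x` the machine halts after at most `T` steps with the answer `b`. -/
def AnswersWithin (M : Machine r) (x : Fin r → List Bool) (T : ℕ) (b : Bool) : Prop :=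
  ∃ t ≤ T, M.answer ((M.step x)^[t] M.init).state = some b

end Machine

/-! ### The classes para-AC⁰ and nonuniform para-AC⁰ -/

/-- A family of circuits `C n k` with `n` input variables. -/
abbrev CircuitFamily : Type := (n : ℕ) → ℕ → Circuit n

/-- The depth is bounded by a constant. -/
def CircuitFamily.BoundedDepth (C : CircuitFamily) : Prop :=
  ∃ d : ℕ, ∀ n k, (C n k).depth ≤ d

/-- The size is at most `f k` times a polynomial in `n`. -/
def CircuitFamily.SizeBoundedBy (C : CircuitFamily) (f : ℕ → ℕ) : Prop :=
  ∃ c : ℕ, ∀ n k, (C n k).size ≤ f k * (n + 1) ^ c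

/-- There is a deterministic Turing machine that computes `C n k` from `1ⁿ` and `1ᵏ` in
time `g k + O(log n)` for some computable `g`, in the sense that within this time it decides
whether the bit in position `i` of the binary encoding of `C n k` is `b`, where
`b`, `i` (in binary), `1ⁿ` and `1ᵏ` are given as input words. -/
def CircuitFamily.Uniform (C : CircuitFamily) : Prop :=
  ∃ (M : Machine 4) (g : ℕ → ℕ) (c : ℕ), Computable g ∧
    ∀ (n k i : ℕ) (b : Bool),
      M.AnswersWithin ![[b], Nat.bits i, List.replicate n true, List.replicate k true]
        (g k + c * Nat.log 2 n) (decide ((C n k).code[i]? = some b))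

/-- A parameterized promise problem: the yes-instances, the no-instances, and the
parameterization. Nothing is required of strings that are neither. -/
structure PromiseProblem : Type where
  yes : Set (List Bool)
  no : Set (List Bool)
  param : List Bool → ℕ

/-- A parameterized problem: a language over `{0,1}` and a parameterization. -/
structure ParamProblem : Type where
  language : Set (List Bool)
  param : List Bool → ℕ

/-- A parameterized problem is a promise problem with the trivial promise. -/
def ParamProblem.toPromise (P : ParamProblem) : PromiseProblem :=
  ⟨P.language, P.languageᶜ, P.param⟩

/-- On every instance `x` that satisfies the promise, the circuit for the length and the
parameter of `x` gives the right answer. -/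
def CircuitFamily.Decides (C : CircuitFamily) (P : PromiseProblem) : Prop :=
  (∀ x ∈ P.yes, (C x.length (P.param x)).eval x.get = true) ∧
  (∀ x ∈ P.no, (C x.length (P.param x)).eval x.get = false)

/-- The class para-AC⁰ (of promise problems). -/
def PromiseProblem.InParaAC0 (P : PromiseProblem) : Prop :=
  ∃ C : CircuitFamily, C.BoundedDepth ∧ (∃ f : ℕ → ℕ, Computable f ∧ C.SizeBoundedBy f) ∧
    C.Decides P ∧ C.Uniform

/-- The nonuniform version of para-AC⁰: the circuits need not be computable, and neither
need the factor `f` in the bound on their size. -/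
def PromiseProblem.InNonuniformParaAC0 (P : PromiseProblem) : Prop :=
  ∃ C : CircuitFamily, C.BoundedDepth ∧ (∃ f : ℕ → ℕ, C.SizeBoundedBy f) ∧ C.Decides P

/-- The class para-AC⁰ (of parameterized problems). -/
def ParamProblem.InParaAC0 (P : ParamProblem) : Prop := P.toPromise.InParaAC0

/-- The nonuniform version of para-AC⁰ (of parameterized problems). -/
def ParamProblem.InNonuniformParaAC0 (P : ParamProblem) : Prop :=
  P.toPromise.InNonuniformParaAC0

/-! ### The clique problem and its gap version -/

open Classical in
/-- The encoding of a pair `(G, k)` as a string: the binary digits of `k`, each of them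
written twice, then `01` as a separator, then the adjacency matrix of `G` row by row. -/
noncomputable def encode {m : ℕ} (G : SimpleGraph (Fin m)) (k : ℕ) : List Bool :=
  (Nat.bits k).flatMap (fun b => [b, b]) ++ [false, true] ++
    List.ofFn fun p : Fin (m * m) => decide (G.Adj p.divNat p.modNat)

/-- The digits that are written twice at the beginning of a string. -/
def paramBits : List Bool → List Bool
  | false :: false :: x => false :: paramBits x
  | true :: true :: x => true :: paramBits x
  | _ => []

/-- The parameterization of the clique problems: it reads off `k`. -/
def cliqueParam (x : List Bool) : ℕ := ofBits (paramBits x)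

theorem cliqueParam_encode {m : ℕ} (G : SimpleGraph (Fin m)) (k : ℕ) :
    cliqueParam (encode G k) = k := by
  have h1 : ∀ l z : List Bool,
      paramBits (l.flatMap (fun b => [b, b]) ++ [false, true] ++ z) = l := by
    intro l z
    induction l with
    | nil => simp [paramBits]
    | cons b l ih => cases b <;> simpa [paramBits] using ih
  have h2 : ∀ k : ℕ, ofBits (Nat.bits k) = k := by
    intro k
    induction k using Nat.binaryRec' with
    | zero => simp [ofBits]
    | bit b n hb ih =>
      rw [Nat.bits_append_bit n b hb]
      simpa [ofBits] using congrArg (Nat.bit b) ih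
  unfold cliqueParam encode
  rw [h1, h2]

/-- `p-Clique`: given a graph `G` and `k`, does `G` contain a clique with `k` vertices? -/
def pClique : ParamProblem where
  language := {x | ∃ (m : ℕ) (G : SimpleGraph (Fin m)) (k : ℕ),
    x = encode G k ∧ ∃ s : Finset (Fin m), G.IsNClique k s}
  param := cliqueParam

/-- `p-Gap-Clique` with ratio `ρ`: given a graph `G` and `k` such that
`k ≤ ω(G) / ρ(ω(G))` or `k > ω(G)`, decide whether the former holds. -/
def pGapClique (ρ : ℕ → ℝ) : PromiseProblem where
  yes := {x | ∃ (m : ℕ) (G : SimpleGraph (Fin m)) (k : ℕ),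
    x = encode G k ∧ (k : ℝ) ≤ (G.cliqueNum : ℝ) / ρ G.cliqueNum}
  no := {x | ∃ (m : ℕ) (G : SimpleGraph (Fin m)) (k : ℕ),
    x = encode G k ∧ G.cliqueNum < k}
  param := cliqueParam

/-- The set `A` of accepted strings is that of a cost approximation for `p-Clique` with
approximation ratio `ρ`. -/
def IsCostApproximation (ρ : ℕ → ℝ) (A : Set (List Bool)) : Prop :=
  ∀ (m : ℕ) (G : SimpleGraph (Fin m)) (k : ℕ),
    ((k : ℝ) ≤ (G.cliqueNum : ℝ) / ρ G.cliqueNum → encode G k ∈ A) ∧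
    (G.cliqueNum < k → encode G k ∉ A)

/-- A function from the natural numbers to the nonnegative reals is computable if
dyadic approximations of its values of any precision can be computed. -/
def ComputableRealFun (ρ : ℕ → ℝ) : Prop :=
  ∃ a : ℕ → ℕ → ℕ, Computable₂ a ∧ ∀ k j, |ρ k - (a k j : ℝ) / 2 ^ j| ≤ 1 / 2 ^ j

end ParaAC

namespace ParaAC

/-! ### Certificates on vertex sets -/

section Certificates

/-! A circuit of constant depth and size `F * (L + 1) ^ c` cannot notice a planted clique. Restrict
the edge relation at random: each vertex stays alive with probability `1 / Q`, and each pair not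
inside the surviving set is fixed, being true with probability `1 / P`. If a function has its value
`true` certified by `s` vertices, then `switching` shows that after the restriction both of its
values almost always are. One restriction per level makes `s` vertices certify every gate
(`exists_restriction_depth`), while many vertices survive and each level adds fewer than `r`
vertices to a clique among the dead ones.

Leave the surviving set empty of edges: the clique number is then at most `d * r + 1`. The output is
certified by `s` vertices, so a clique of any prescribed size that fits can be planted on the other
survivors without changing it (`exists_indistinguishable`).

The order of quantifiers decides. As `P` and `Q` are powers of a large `B` and the number of
vertices is polynomial in `B`, the bound `k₀` on the small clique number depends only on depth and
exponent (`exists_plantable_clique`). Hence the parameter can be set to `k₀`, the factor `f k₀` is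
just a constant, and the planted clique may be so large that `k₀ ≤ ω / ρ(ω)`. One circuit then gives
the same answer on a yes-instance and a no-instance. Neither uniformity nor computability plays a
role. -/

theorem mem_square_mono {U : Type} {V W : Finset U} (h : V ⊆ W) {e : U × U} (he : e ∈ V ×ˢ V) :
    e ∈ W ×ˢ W := Finset.product_subset_product h h he

variable {U β : Type} [DecidableEq U]

/-- `η` on the pairs inside `V`, and `x` on all others. -/
def overwrite (V : Finset U) (η x : U × U → β) : U × U → β :=
  fun e => if e ∈ V ×ˢ V then η e else x e

theorem overwrite_of_mem {V : Finset U} {e : U × U} (h : e ∈ V ×ˢ V) (η x : U × U → β) :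
    overwrite V η x e = η e := if_pos h

theorem overwrite_of_notMem {V : Finset U} {e : U × U} (h : e ∉ V ×ˢ V) (η x : U × U → β) :
    overwrite V η x e = x e := if_neg h

def AgreeOff (A : Finset U) (H H' : U × U → Bool) : Prop := ∀ e, e ∉ A ×ˢ A → H e = H' e

def AgreeOn (S : Finset U) (H H' : U × U → Bool) : Prop := ∀ e ∈ S ×ˢ S, H e = H' e

/-- On the relations that agree with `ρ` outside of `A`, every value of `f` is
certified by the pairs inside some set of at most `s` vertices. -/
def Certified (f : (U × U → Bool) → Bool) (ρ : U × U → Bool) (A : Finset U) (s : ℕ) : Prop :=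
  ∀ H, AgreeOff A H ρ → ∃ S : Finset U, S.card ≤ s ∧
    ∀ H', AgreeOff A H' ρ → AgreeOn S H H' → f H' = f H

/-- As `Certified`, for the value `true` only. -/
def CertifiedTrue (f : (U × U → Bool) → Bool) (ρ : U × U → Bool) (A : Finset U) (s : ℕ) : Prop :=
  ∀ H, AgreeOff A H ρ → f H = true → ∃ S : Finset U, S.card ≤ s ∧
    ∀ H', AgreeOff A H' ρ → AgreeOn S H H' → f H' = true

theorem AgreeOff.of_overwrite {A A' : Finset U} (hA : A' ⊆ A) {H x ρ : U × U → Bool}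
    (h : AgreeOff A' H (overwrite A x ρ)) : AgreeOff A H ρ := fun e he => by
  rw [h e fun h' => he (mem_square_mono hA h'), overwrite_of_notMem he]

end Certificates

/-! ### The switching lemma -/

section Switching

variable {U α β : Type} [Fintype U] [DecidableEq U] [Fintype α] [DecidableEq α]
  [Fintype β] [DecidableEq β]

/-- Take least elements for a well-order. The point is stability: the choice survives passing to any
subset that still contains it. -/
theorem exists_selector (τ : Type) : ∃ first : Set τ → Option τ, ∀ 𝒮 : Set τ, 𝒮.Nonempty →
    ∃ C ∈ 𝒮, ∀ 𝒮' ⊆ 𝒮, C ∈ 𝒮' → first 𝒮' = some C := by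
  classical
  let _ : LinearOrder τ := linearOrderOfSTO WellOrderingRel
  have wf : WellFounded ((· < ·) : τ → τ → Prop) :=
    (inferInstance : IsWellOrder τ WellOrderingRel).wf
  refine ⟨fun 𝒮 => if h : 𝒮.Nonempty then some (wf.min 𝒮 h) else none, fun 𝒮 h => ?_⟩
  refine ⟨wf.min 𝒮 h, wf.min_mem 𝒮 h, fun 𝒮' hs hC => ?_⟩
  have h' : 𝒮'.Nonempty := ⟨_, hC⟩
  simp only [h', dif_pos]
  congr 1
  apply le_antisymm
  · exact not_lt.1 (wf.not_lt_min _ hC)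
  · exact not_lt.1 (wf.not_lt_min _ (hs (wf.min_mem 𝒮' h')))

/-- The relations that vanish outside of `V`. -/
def patterns (V : Finset U) : Finset (U × U → Bool) :=
  Fintype.piFinset fun e => if e ∈ V ×ˢ V then Finset.univ else {false}

theorem card_patterns (V : Finset U) : (patterns V).card = 2 ^ (V.card * V.card) := by
  unfold patterns
  rw [Fintype.card_piFinset, ← Finset.card_product, ← Finset.prod_const]
  rw [← Finset.prod_subset (Finset.subset_univ (V ×ˢ V))]
  · exact Finset.prod_congr rfl fun e he => by rw [if_pos he]; simp
  · intro e _ he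
    rw [if_neg he]; simp

theorem overwrite_false_mem_patterns (V : Finset U) (H : U × U → Bool) :
    overwrite V H (fun _ => false) ∈ patterns V := by
  refine Fintype.mem_piFinset.2 fun e => ?_
  unfold overwrite
  split_ifs <;> simp

/-- The vertex sets that can be reached from `V` by at most `m` times adding a part of the set
selected from the current knowledge, as long as the set has at most `s` elements. -/
def reach (sel : (U × U → Bool) → Finset U) (x : U × U → Bool) (s : ℕ) :
    ℕ → Finset U → (U × U → Bool) → Finset (Finset U)
  | 0, V, _ => {V}
  | m + 1, V, η =>
    if V.card ≤ s then
      (sel (overwrite V η x)).powerset.biUnion fun W =>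
        (patterns (V ∪ W)).biUnion fun η' => reach sel x s m (V ∪ W) η'
    else {V}

/-- A round only runs when `V` has at most `s` vertices, so it offers at most `2 ^ s` parts `W` and
`2 ^ (2s * 2s)` patterns on `V ∪ W`. -/
theorem card_reach_le {sel : (U × U → Bool) → Finset U} {s : ℕ} (hsel : ∀ H, (sel H).card ≤ s)
    (x : U × U → Bool) (m : ℕ) (V : Finset U) (η : U × U → Bool) :
    (reach sel x s m V η).card ≤ (2 ^ s * 2 ^ (2 * s * (2 * s))) ^ m := by
  induction m generalizing V η with
  | zero => simp [reach]
  | succ m ih =>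
    rw [reach]
    split_ifs with hV
    · rw [pow_succ', mul_assoc]
      refine (Finset.card_biUnion_le_card_mul _ _
        (2 ^ (2 * s * (2 * s)) * (2 ^ s * 2 ^ (2 * s * (2 * s))) ^ m) ?_).trans ?_
      · intro W hW
        have hc : (V ∪ W).card ≤ 2 * s := by
          have := Finset.card_union_le V W
          have := Finset.card_le_card (Finset.mem_powerset.1 hW)
          have := hsel (overwrite V η x)
          omega
        refine (Finset.card_biUnion_le_card_mul _ _ _ fun η' _ => ih (V ∪ W) η').trans ?_
        rw [card_patterns]
        gcongr
        norm_num
      · rw [Finset.card_powerset]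
        gcongr
        · norm_num
        · exact hsel _
    · simpa using Nat.one_le_pow _ _ (by positivity)

theorem self_mem_reach {sel : (U × U → Bool) → Finset U} {x : U × U → Bool} {s m : ℕ}
    {V : Finset U} {η : U × U → Bool} (h : s < V.card) : V ∈ reach sel x s m V η := by
  cases m with
  | zero => simp [reach]
  | succ m => simp [reach, not_le.2 h]

/-- The Boolean relation given by a labelling of the pairs. -/
def decode (b₀ : β) (b : U × U → β) : U × U → Bool := fun e => decide (b e = b₀)

/-- The encoding behind the switching lemma. A bad restriction `(A', b)` yields a set `V` of more
than `s` survivors and a labelling `b'`, equal to `b` off `V`, such that `V` is among the few sets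
recoverable from `b'` without knowing `A'`. -/
theorem exists_reach {f : (U × U → Bool) → Bool} {ρ : U × U → Bool} {A : Finset U} {s : ℕ}
    [Nontrivial β] (b₀ : β) (hf : CertifiedTrue f ρ A s) :
    ∃ sel : (U × U → Bool) → Finset U, (∀ H, (sel H).card ≤ s) ∧
      ∀ (A' : Finset U) (b : U × U → β), A' ⊆ A →
        ¬ Certified f (overwrite A (decode b₀ b) ρ) A' s →
        ∃ (V : Finset U) (b' : U × U → β), V ⊆ A' ∧ s < V.card ∧ V.card ≤ 2 * s ∧
          (∀ e, e ∉ V ×ˢ V → b e = b' e) ∧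
          V ∈ reach sel (overwrite A (decode b₀ b') ρ) s (s + 1) ∅
            (overwrite ∅ (fun _ => false) fun _ => false) := by
  classical
  obtain ⟨b₁, hb₁⟩ := exists_ne b₀
  obtain ⟨first, hfirst⟩ := exists_selector (Finset U × (U × U → Bool))
  let 𝒯 : Set (Finset U × (U × U → Bool)) := {C | C.1.card ≤ s ∧
    ∀ H', AgreeOff A H' ρ → AgreeOn C.1 C.2 H' → f H' = true}
  let sel : (U × U → Bool) → Finset U := fun H =>
    match first {C | C ∈ 𝒯 ∧ AgreeOn C.1 C.2 H} with
    -- Nothing is known about `first` on the empty family; the test keeps the size bound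
    -- unconditional.
    | some C => if C.1.card ≤ s then C.1 else ∅
    | none => ∅
  have hsel : ∀ H, (sel H).card ≤ s := by
    intro H
    simp only [sel]
    split
    · split_ifs <;> simp_all
    · simp
  refine ⟨sel, hsel, fun A' b hA hbad => ?_⟩
  unfold Certified at hbad
  push Not at hbad
  obtain ⟨H, hH, hcert⟩ := hbad
  have key : ∀ (m : ℕ) (V : Finset U), V ⊆ A' → V.card ≤ s → s < V.card + m →
      ∀ c : U × U → β, (∀ e, e ∉ V ×ˢ V → b e = c e) →
      ∃ (W : Finset U) (b' : U × U → β), W ⊆ A' ∧ s < W.card ∧ W.card ≤ 2 * s ∧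
        (∀ e, e ∉ W ×ˢ W → b e = b' e) ∧ (∀ e ∈ V ×ˢ V, b' e = c e) ∧
        W ∈ reach sel (overwrite A (decode b₀ b') ρ) s m V
          (overwrite V H fun _ => false) := by
    intro m
    induction m with
    | zero => intro V _ h1 h2; omega
    | succ m ih =>
      intro V hVA hVs hm c hc
      -- the terms that are not falsified by what is known on `V`
      let 𝒩 : Set (Finset U × (U × U → Bool)) := {C | C ∈ 𝒯 ∧
        ∀ e ∈ C.1 ×ˢ C.1, (e ∈ A' ×ˢ A' → e ∈ V ×ˢ V) → C.2 e = H e}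
      obtain ⟨H', hH', hHH', hne⟩ := hcert V hVs
      have h𝒩 : 𝒩.Nonempty := by
        -- As `V` is no certificate, `f` takes both values on relations compatible with it; a
        -- certificate at one where `f` is true is not falsified by the knowledge on `V`.
        have : ∀ G, AgreeOff A' G (overwrite A (decode b₀ b) ρ) → AgreeOn V H G → f G = true →
            𝒩.Nonempty := by
          intro G hG hHG hfG
          obtain ⟨S, hS, hS'⟩ := hf G (hG.of_overwrite hA) hfG
          refine ⟨(S, G), ⟨hS, hS'⟩, fun e _ he => ?_⟩
          by_cases heA : e ∈ A' ×ˢ A'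
          · exact (hHG e (he heA)).symm
          · exact (hG e heA).trans (hH e heA).symm
        cases hfH : f H with
        | true => exact this H hH (fun _ _ => rfl) hfH
        | false =>
          refine this H' hH' hHH' ?_
          rw [hfH] at hne
          simpa using hne
      obtain ⟨C, hC, hCfirst⟩ := hfirst 𝒩 h𝒩
      obtain ⟨S, T⟩ := C
      have hS : S.card ≤ s := hC.1.1
      set V₁ := V ∪ (S ∩ A') with hV₁
      have hV₁A : V₁ ⊆ A' := Finset.union_subset hVA Finset.inter_subset_right
      have hVV₁ : V ⊆ V₁ := Finset.subset_union_left
      have hSA : ∀ e ∈ S ×ˢ S, e ∈ A' ×ˢ A' → e ∈ V₁ ×ˢ V₁ := by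
        intro e he he'
        simp only [Finset.mem_product, hV₁, Finset.mem_union, Finset.mem_inter] at *
        tauto
      have hgrow : V.card < V₁.card := by
        -- If `S ∩ A'` brought nothing new, the selected term would already hold and force `f` to be
        -- true at both `H` and `H'`.
        refine Finset.card_lt_card (Finset.ssubset_iff_subset_ne.2 ⟨hVV₁, fun heq => hne ?_⟩)
        have hall : ∀ G, AgreeOff A' G (overwrite A (decode b₀ b) ρ) → AgreeOn V H G →
            f G = true := by
          intro G hG hHG
          refine hC.1.2 G (hG.of_overwrite hA) fun e he => ?_
          have h1 := hC.2 e he fun h' => by rw [heq]; exact hSA e he h'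
          rw [h1]
          by_cases heA : e ∈ A' ×ˢ A'
          · exact hHG e (by rw [heq]; exact hSA e he heA)
          · exact (hH e heA).trans (hG e heA).symm
        rw [hall H' hH' hHH', hall H hH fun _ _ => rfl]
      have hV₁card : V₁.card ≤ 2 * s := by
        have : V₁.card ≤ _ := Finset.card_union_le V (S ∩ A')
        have := Finset.card_le_card (Finset.inter_subset_left (s₁ := S) (s₂ := A'))
        omega
      -- Relabel the new pairs so that they satisfy the selected term; this is what lets the decoder
      -- find it.
      let c₁ : U × U → β := fun e =>
        if e ∈ V₁ ×ˢ V₁ ∧ e ∉ V ×ˢ V ∧ e ∈ S ×ˢ S then (if T e then b₀ else b₁) else c e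
      have hc₁ : ∀ e, e ∉ V₁ ×ˢ V₁ → b e = c₁ e := by
        intro e he
        simp only [c₁, he, false_and, if_false]
        exact hc e fun h' => he (mem_square_mono hVV₁ h')
      have hc₁V : ∀ e ∈ V ×ˢ V, c₁ e = c e := by
        intro e he
        exact if_neg fun h => h.2.1 he
      have hstep : ∀ (W : Finset U) (b' : U × U → β), W ⊆ A' →
          (∀ e, e ∉ W ×ˢ W → b e = b' e) → (∀ e ∈ V₁ ×ˢ V₁, b' e = c₁ e) →
          W ∈ reach sel (overwrite A (decode b₀ b') ρ) s m V₁ (overwrite V₁ H fun _ => false) →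
          W ∈ reach sel (overwrite A (decode b₀ b') ρ) s (m + 1) V
            (overwrite V H fun _ => false) := by
        intro W b' hWA hb' hb'c hW
        rw [reach, if_pos hVs]
        set K := overwrite V (overwrite V H fun _ => false) (overwrite A (decode b₀ b') ρ)
        have hK : ∀ e, (e ∈ A' ×ˢ A' → e ∈ V ×ˢ V) → K e = H e := by
          intro e he
          by_cases heV : e ∈ V ×ˢ V
          · simp only [K, overwrite_of_mem heV]
          · have heA : e ∉ A' ×ˢ A' := fun h' => heV (he h')
            have heb : b e = b' e := hb' e fun h' => heA (mem_square_mono hWA h')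
            rw [hH e heA]
            simp only [K, overwrite_of_notMem heV]
            unfold overwrite decode
            rw [heb]
        -- The decoder sees the terms satisfied by `K`. They form a subset of `𝒩` containing `(S,
        -- T)`, so stability of the selector yields the same term.
        have hsub : {C | C ∈ 𝒯 ∧ AgreeOn C.1 C.2 K} ⊆ 𝒩 := fun C hC' =>
          ⟨hC'.1, fun e he he' => (hC'.2 e he).trans (hK e he')⟩
        have hmem : (S, T) ∈ {C | C ∈ 𝒯 ∧ AgreeOn C.1 C.2 K} := by
          refine ⟨hC.1, fun e he => ?_⟩
          by_cases hdet : e ∈ A' ×ˢ A' → e ∈ V ×ˢ V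
          · rw [hK e hdet]
            exact hC.2 e he hdet
          · push Not at hdet
            have h1 := hSA e he hdet.1
            simp only [K, overwrite_of_notMem hdet.2,
              overwrite_of_mem (mem_square_mono hA hdet.1)]
            simp only [decode, hb'c e h1, c₁, h1, hdet.2, true_and, not_false_eq_true,
              show e ∈ S ×ˢ S from he, if_true]
            cases T e <;> simp [hb₁]
        have hselK : sel K = S := by
          simp only [sel, hCfirst _ hsub hmem, hS, if_true]
        rw [hselK]
        exact Finset.mem_biUnion.2 ⟨S ∩ A', Finset.mem_powerset.2 Finset.inter_subset_left,
          Finset.mem_biUnion.2 ⟨_, overwrite_false_mem_patterns V₁ H, hW⟩⟩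
      by_cases hbig : s < V₁.card
      · exact ⟨V₁, c₁, hV₁A, hbig, hV₁card, hc₁, hc₁V,
          hstep V₁ c₁ hV₁A hc₁ (fun _ _ => rfl) (self_mem_reach hbig)⟩
      · obtain ⟨W, b', hWA, hsW, hWs, hb', hb'c, hW⟩ :=
          ih V₁ hV₁A (not_lt.1 hbig) (by omega) c₁ hc₁
        exact ⟨W, b', hWA, hsW, hWs, hb',
          fun e he => (hb'c e (mem_square_mono hVV₁ he)).trans (hc₁V e he),
          hstep W b' hWA hb' hb'c hW⟩
  obtain ⟨W, b', hWA, hsW, hWs, hb', -, hW⟩ :=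
    key (s + 1) ∅ (Finset.empty_subset _) (Nat.zero_le _) (by simp) b fun _ _ => rfl
  refine ⟨W, b', hWA, hsW, hWs, hb', ?_⟩
  convert hW using 2
  funext e
  simp [overwrite]

theorem card_filter_eq_off {ι : Type} [Fintype ι] [DecidableEq ι] (Z : Finset ι) (b' : ι → β) :
    (Finset.univ.filter fun b : ι → β => ∀ e, e ∉ Z → b e = b' e).card =
      Fintype.card β ^ Z.card := by
  have : (Finset.univ.filter fun b : ι → β => ∀ e, e ∉ Z → b e = b' e) =
      Fintype.piFinset fun e => if e ∈ Z then Finset.univ else {b' e} := by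
    ext b
    simp only [Finset.mem_filter, Finset.mem_univ, true_and, Fintype.mem_piFinset]
    refine forall_congr' fun e => ?_
    by_cases h : e ∈ Z <;> simp [h]
  rw [this, Fintype.card_piFinset, ← Finset.prod_const,
    ← Finset.prod_subset (Finset.subset_univ Z)]
  · exact Finset.prod_congr rfl fun e he => by rw [if_pos he, Finset.card_univ]
  · intro e _ he
    rw [if_neg he, Finset.card_singleton]

theorem card_filter_eq_on {ι : Type} [Fintype ι] [DecidableEq ι] (Z : Finset ι) (b₀ : β) :
    (Finset.univ.filter fun b : ι → β => ∀ e ∈ Z, b e = b₀).card * Fintype.card β ^ Z.card =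
      Fintype.card β ^ Fintype.card ι := by
  have h := card_filter_eq_off (Zᶜ) (fun _ => b₀)
  have h' : (Finset.univ.filter fun b : ι → β => ∀ e ∈ Z, b e = b₀) =
      Finset.univ.filter fun b : ι → β => ∀ e, e ∉ Zᶜ → b e = b₀ := by
    ext b; simp
  rw [h', h, ← pow_add, Finset.card_compl_add_card]

-- Union bound over the encodings. For fixed `b'` and `V` with `v` vertices, survival of `V` costs a
-- factor `Q ^ v`, while forgetting `b'` on `V` gains only `P ^ (v * v)`, where `Q` and `P` are the
-- cardinalities of `α` and `β`.
open Classical in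
theorem switching {f : (U × U → Bool) → Bool} {ρ : U × U → Bool} {A : Finset U} {s Z : ℕ}
    [Nontrivial β] (a₀ : α) (b₀ : β) (hf : CertifiedTrue f ρ A s)
    (hZ : ∀ v, s < v → v ≤ 2 * s → Fintype.card β ^ (v * v) * Z ≤ Fintype.card α ^ v) :
    (Finset.univ.filter fun ω : (U → α) × (U × U → β) =>
      ¬ Certified f (overwrite A (decode b₀ ω.2) ρ) (A.filter fun i => ω.1 i = a₀) s).card * Z ≤
    (2 ^ s * 2 ^ (2 * s * (2 * s))) ^ (s + 1) * Fintype.card ((U → α) × (U × U → β)) := by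
  obtain ⟨sel, hsel, hreach⟩ := exists_reach b₀ hf
  let D : (U × U → β) → Finset (Finset U) := fun b' =>
    (reach sel (overwrite A (decode b₀ b') ρ) s (s + 1) ∅
      (overwrite ∅ (fun _ => false) fun _ => false)).filter fun V => s < V.card ∧ V.card ≤ 2 * s
  let X : (U × U → β) → Finset U → Finset ((U → α) × (U × U → β)) := fun b' V =>
    (Finset.univ.filter fun a : U → α => ∀ i ∈ V, a i = a₀) ×ˢ
      (Finset.univ.filter fun b : U × U → β => ∀ e, e ∉ V ×ˢ V → b e = b' e)
  have hsub : (Finset.univ.filter fun ω : (U → α) × (U × U → β) =>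
      ¬ Certified f (overwrite A (decode b₀ ω.2) ρ) (A.filter fun i => ω.1 i = a₀) s) ⊆
      Finset.univ.biUnion fun b' => (D b').biUnion (X b') := by
    rintro ⟨a, b⟩ hω
    obtain ⟨V, b', hVA, h1, h2, hb, hV⟩ :=
      hreach _ b (Finset.filter_subset _ _) (Finset.mem_filter.1 hω).2
    refine Finset.mem_biUnion.2 ⟨b', Finset.mem_univ _, Finset.mem_biUnion.2
      ⟨V, Finset.mem_filter.2 ⟨hV, h1, h2⟩, Finset.mem_product.2 ⟨?_, ?_⟩⟩⟩
    · exact Finset.mem_filter.2 ⟨Finset.mem_univ _, fun i hi => (Finset.mem_filter.1 (hVA hi)).2⟩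
    · exact Finset.mem_filter.2 ⟨Finset.mem_univ _, hb⟩
  have hX : ∀ b', ∀ V ∈ D b', (X b' V).card * Z ≤ Fintype.card α ^ Fintype.card U := by
    intro b' V hV
    obtain ⟨-, h1, h2⟩ := Finset.mem_filter.1 hV
    rw [Finset.card_product, card_filter_eq_off, Finset.card_product, mul_assoc]
    exact (Nat.mul_le_mul_left _ (hZ _ h1 h2)).trans (card_filter_eq_on V a₀).le
  have hD : ∀ b', (D b').card ≤ (2 ^ s * 2 ^ (2 * s * (2 * s))) ^ (s + 1) := fun b' =>
    (Finset.card_filter_le _ _).trans (card_reach_le hsel _ _ _ _)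
  calc _ ≤ (∑ b', ∑ V ∈ D b', (X b' V).card) * Z := by
        gcongr
        refine (Finset.card_le_card hsub).trans (Finset.card_biUnion_le.trans ?_)
        exact Finset.sum_le_sum fun b' _ => Finset.card_biUnion_le
    _ = ∑ b', ∑ V ∈ D b', (X b' V).card * Z := by simp only [Finset.sum_mul]
    _ ≤ ∑ b' : U × U → β, (2 ^ s * 2 ^ (2 * s * (2 * s))) ^ (s + 1) *
          Fintype.card α ^ Fintype.card U := by
        refine Finset.sum_le_sum fun b' _ => (Finset.sum_le_card_nsmul _ _ _ (hX b')).trans ?_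
        rw [smul_eq_mul]
        gcongr
        exact hD b'
    _ = _ := by
        rw [Finset.sum_const, smul_eq_mul, Finset.card_univ, Fintype.card_prod,
          Fintype.card_fun (α := U)]
        ring

end Switching

/-! ### One restriction for a whole level -/

section Stage

variable {U α β : Type} [Fintype U] [DecidableEq U] [Fintype α] [DecidableEq α]
  [Fintype β] [DecidableEq β]

open Classical in
/-- Few labellings contain a clique of size `r`. -/
theorem card_clique_le (b₀ : β) (r : ℕ) :
    (Finset.univ.filter fun b : U × U → β =>
      ∃ R : Finset U, R.card = r ∧ ∀ e ∈ R.offDiag, b e = b₀).card *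
        Fintype.card β ^ (r * r - r) ≤
      Fintype.card U ^ r * Fintype.card (U × U → β) := by
  have hsub : (Finset.univ.filter fun b : U × U → β =>
      ∃ R : Finset U, R.card = r ∧ ∀ e ∈ R.offDiag, b e = b₀) ⊆
      (Finset.univ.powersetCard r).biUnion fun R =>
        Finset.univ.filter fun b : U × U → β => ∀ e ∈ R.offDiag, b e = b₀ := by
    intro b hb
    obtain ⟨R, hR, hb⟩ := (Finset.mem_filter.1 hb).2
    exact Finset.mem_biUnion.2 ⟨R, Finset.mem_powersetCard.2 ⟨Finset.subset_univ _, hR⟩,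
      Finset.mem_filter.2 ⟨Finset.mem_univ _, hb⟩⟩
  calc _ ≤ (∑ R ∈ Finset.univ.powersetCard r, (Finset.univ.filter fun b : U × U → β =>
          ∀ e ∈ R.offDiag, b e = b₀).card) * Fintype.card β ^ (r * r - r) := by
        gcongr
        exact (Finset.card_le_card hsub).trans Finset.card_biUnion_le
    _ = ∑ R ∈ (Finset.univ : Finset U).powersetCard r, Fintype.card (U × U → β) := by
        rw [Finset.sum_mul]
        refine Finset.sum_congr rfl fun R hR => ?_
        have h := card_filter_eq_on (R.offDiag) b₀
        rw [Finset.offDiag_card, (Finset.mem_powersetCard.1 hR).2] at h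
        rw [h, Fintype.card_fun]
    _ ≤ _ := by
        rw [Finset.sum_const, smul_eq_mul, Finset.card_powersetCard, Finset.card_univ]
        gcongr
        exact Nat.choose_le_pow _ _

/-- Averaging: the mean number of survivors is `|A| / Q`, with `Q` the cardinality of `α`, and bad
outcomes contribute less than half of it. -/
theorem exists_large_filter [Nonempty β] (a₀ : α) {A : Finset U} (hA : A.Nonempty)
    {Bad : Finset ((U → α) × (U × U → β))}
    (hBad : Bad.card * (2 * Fintype.card α) < Fintype.card ((U → α) × (U × U → β))) :
    ∃ ω ∉ Bad, A.card ≤ 2 * Fintype.card α * (A.filter fun i => ω.1 i = a₀).card := by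
  by_contra! hcon
  set Q := Fintype.card α
  set N := Fintype.card ((U → α) × (U × U → β)) with hN
  have hone : ∀ i : U, (∑ ω : (U → α) × (U × U → β), if ω.1 i = a₀ then 1 else 0) * Q = N := by
    intro i
    have h := card_filter_eq_on {i} a₀
    simp only [Finset.mem_singleton, forall_eq, Finset.card_singleton, pow_one] at h
    have hprod : (Finset.univ.filter fun ω : (U → α) × (U × U → β) => ω.1 i = a₀) =
        (Finset.univ.filter fun a : U → α => a i = a₀) ×ˢ Finset.univ := by
      ext; simp
    rw [← Finset.card_filter, hprod, Finset.card_product, mul_right_comm, h, hN,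
      Fintype.card_prod, Fintype.card_fun (α := U), Finset.card_univ]
  have hsum : ∑ ω : (U → α) × (U × U → β), 2 * Q * (A.filter fun i => ω.1 i = a₀).card =
      2 * (A.card * N) := by
    simp only [Finset.card_filter]
    rw [← Finset.mul_sum, Finset.sum_comm, ← smul_eq_mul A.card, ← Finset.sum_const,
      mul_assoc, mul_comm Q, Finset.sum_mul]
    congr 1
    exact Finset.sum_congr rfl fun i _ => hone i
  have hle : ∑ ω : (U → α) × (U × U → β), 2 * Q * (A.filter fun i => ω.1 i = a₀).card ≤
      ∑ ω : (U → α) × (U × U → β), ((if ω ∈ Bad then 2 * Q * A.card else 0) + A.card) := by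
    refine Finset.sum_le_sum fun ω _ => ?_
    split_ifs with h
    · exact (Nat.mul_le_mul_left _ (Finset.card_filter_le _ _)).trans (Nat.le_add_right _ _)
    · rw [zero_add]; exact (hcon ω h).le
  rw [hsum, Finset.sum_add_distrib, ← Finset.sum_filter, Finset.sum_const, Finset.sum_const,
    Finset.filter_mem_eq_inter, Finset.univ_inter, Finset.card_univ, ← hN, smul_eq_mul,
    smul_eq_mul] at hle
  have hApos := hA.card_pos
  nlinarith

theorem mul_lt_of_mul_le {x q m z N : ℕ} (hN : 0 < N) (h1 : x * z ≤ m * N) (h2 : q * m < z) :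
    x * q < N := by
  have h3 : z * (x * q) < z * N := by
    calc z * (x * q) = q * (x * z) := by ring
      _ ≤ q * (m * N) := Nat.mul_le_mul_left _ h1
      _ = q * m * N := by ring
      _ < z * N := Nat.mul_lt_mul_of_pos_right h2 hN
  exact lt_of_mul_lt_mul_left h3 (Nat.zero_le _)

/-- One restriction handles a whole family of functions, leaves many vertices, and fixes a
relation without large cliques. -/
theorem exists_restriction {ι : Type} [Fintype ι] {f : ι → (U × U → Bool) → Bool}
    {ρ : U × U → Bool} {A : Finset U} {s r Z : ℕ} [Nontrivial β] (a₀ : α) (b₀ : β)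
    (hA : A.Nonempty) (hf : ∀ i, CertifiedTrue (f i) ρ A s)
    (hZ : ∀ v, s < v → v ≤ 2 * s → Fintype.card β ^ (v * v) * Z ≤ Fintype.card α ^ v)
    (hM : 4 * Fintype.card α *
      (Fintype.card ι * (2 ^ s * 2 ^ (2 * s * (2 * s))) ^ (s + 1)) < Z)
    (hr : 4 * Fintype.card α * Fintype.card U ^ r < Fintype.card β ^ (r * r - r)) :
    ∃ (A' : Finset U) (x : U × U → Bool), A' ⊆ A ∧
      A.card ≤ 2 * Fintype.card α * A'.card ∧
      (∀ i, Certified (f i) (overwrite A x ρ) A' s) ∧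
      ∀ R : Finset U, (∀ e ∈ R.offDiag, x e = true) → R.card < r := by
  classical
  set N := Fintype.card ((U → α) × (U × U → β)) with hN
  have hNpos : 0 < N := Fintype.card_pos_iff.2 ⟨(fun _ => a₀, fun _ => b₀)⟩
  let B₁ : Finset ((U → α) × (U × U → β)) := Finset.univ.biUnion fun i : ι =>
    Finset.univ.filter fun ω =>
      ¬ Certified (f i) (overwrite A (decode b₀ ω.2) ρ) (A.filter fun i => ω.1 i = a₀) s
  let B₂ : Finset ((U → α) × (U × U → β)) := Finset.univ ×ˢ Finset.univ.filter fun b =>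
    ∃ R : Finset U, R.card = r ∧ ∀ e ∈ R.offDiag, b e = b₀
  have h₁ : B₁.card * Z ≤
      Fintype.card ι * (2 ^ s * 2 ^ (2 * s * (2 * s))) ^ (s + 1) * N := by
    calc B₁.card * Z ≤ ∑ i : ι, (2 ^ s * 2 ^ (2 * s * (2 * s))) ^ (s + 1) * N := by
          refine (Nat.mul_le_mul_right _ Finset.card_biUnion_le).trans ?_
          rw [Finset.sum_mul]
          exact Finset.sum_le_sum fun i _ => by convert switching a₀ b₀ (hf i) hZ
      _ = _ := by
          rw [Finset.sum_const, smul_eq_mul, Finset.card_univ]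
          exact (mul_assoc _ _ _).symm
  have h₂ : B₂.card * Fintype.card β ^ (r * r - r) ≤ Fintype.card U ^ r * N := by
    rw [Finset.card_product, mul_assoc, hN, Fintype.card_prod, Finset.card_univ, mul_left_comm _ _
      (Fintype.card _)]
    refine Nat.mul_le_mul_left _ ?_
    convert card_clique_le b₀ r
  have h₁' := mul_lt_of_mul_le hNpos h₁ hM
  have h₂' := mul_lt_of_mul_le hNpos h₂ hr
  -- Each of the two bad events has probability below `1 / (4Q)`.
  have hBad : (B₁ ∪ B₂).card * (2 * Fintype.card α) < N := by
    have := Nat.mul_le_mul_right (2 * Fintype.card α) (Finset.card_union_le B₁ B₂)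
    nlinarith
  obtain ⟨ω, hω, hlarge⟩ := exists_large_filter a₀ hA hBad
  rw [Finset.mem_union, not_or] at hω
  refine ⟨A.filter fun i => ω.1 i = a₀, decode b₀ ω.2, Finset.filter_subset _ _, hlarge,
    fun i => ?_, fun R hR => ?_⟩
  · by_contra h
    exact hω.1 (Finset.mem_biUnion.2 ⟨i, Finset.mem_univ _,
      Finset.mem_filter.2 ⟨Finset.mem_univ _, h⟩⟩)
  · by_contra! h
    obtain ⟨R', hR', hcard⟩ := Finset.exists_subset_card_eq h
    refine hω.2 (Finset.mem_product.2 ⟨Finset.mem_univ _,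
      Finset.mem_filter.2 ⟨Finset.mem_univ _, R', hcard, fun e he => ?_⟩⟩)
    exact of_decide_eq_true (hR e (Finset.offDiag_mono hR' he))

end Stage

/-! ### Constant-depth circuits -/

section Circuits

variable {L : ℕ}

theorem Certified.of_xor {U : Type} {f : (U × U → Bool) → Bool} {ρ : U × U → Bool} {A : Finset U} {s : ℕ}
    {z : Bool} (h : Certified (fun H => xor z (f H)) ρ A s) : Certified f ρ A s := by
  intro H hH
  obtain ⟨S, hS, hcert⟩ := h H hH
  refine ⟨S, hS, fun H' hH' hS' => ?_⟩
  simpa using hcert H' hH' hS'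

/-- Whether the negation of the gate, rather than the gate, is a disjunction of its possibly
negated inputs. -/
def GateLabel.flip {n : ℕ} : GateLabel n → Bool
  | .and => true
  | .not => true
  | _ => false

theorem certified_input {U : Type} {y : (U × U → Bool) → Fin L → Bool}
    (hy : ∀ i, ∃ S : Finset U, S.card ≤ 2 ∧ ∀ H H', AgreeOn S H H' → y H' i = y H i)
    {s : ℕ} (hs : 2 ≤ s) (ρ : U × U → Bool) (A : Finset U) (i : Fin L) :
    Certified (fun H => y H i) ρ A s := fun H _ => by
  obtain ⟨S, hS, h⟩ := hy i
  exact ⟨S, hS.trans hs, fun H' _ h' => h H H' h'⟩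

variable {U : Type}

/-- One input suffices to make a disjunction true, so its certificate serves for the gate.
Conjunctions and negations are treated through their complements, since `Certified` is blind to
negation. -/
theorem certifiedTrue_gate (C : Circuit L) {y : (U × U → Bool) → Fin L → Bool}
    (hy : ∀ i, ∃ S : Finset U, S.card ≤ 2 ∧ ∀ H H', AgreeOn S H H' → y H' i = y H i)
    {s : ℕ} (hs : 2 ≤ s) {ρ : U × U → Bool} {A : Finset U} (g : Fin C.size)
    (hg : ∀ h ∈ C.inputs g, Certified (fun H => C.value (y H) h) ρ A s) :
    CertifiedTrue (fun H => xor (C.label g).flip (C.value (y H) g)) ρ A s := by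
  intro H hH htrue
  have hv : ∀ H, C.value (y H) g = _ := fun H => C.value_eq (y H) g
  simp only [hv] at htrue ⊢
  cases hl : C.label g with
  | and =>
    simp only [hl, GateLabel.flip, Bool.true_xor, Bool.not_eq_true', decide_eq_false_iff_not,
      not_forall] at htrue ⊢
    obtain ⟨h, hh, hval⟩ := htrue
    obtain ⟨S, hS, hcert⟩ := hg h hh H hH
    exact ⟨S, hS, fun H' hH' hS' => ⟨h, hh, by have := hcert H' hH' hS'; simp_all⟩⟩
  | or =>
    simp only [hl, GateLabel.flip, Bool.false_xor, decide_eq_true_eq] at htrue ⊢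
    obtain ⟨h, hh, hval⟩ := htrue
    obtain ⟨S, hS, hcert⟩ := hg h hh H hH
    exact ⟨S, hS, fun H' hH' hS' => ⟨h, hh, by have := hcert H' hH' hS'; simp_all⟩⟩
  | not =>
    simp only [hl, GateLabel.flip, Bool.true_xor, Bool.not_eq_true', decide_eq_false_iff_not,
      not_forall] at htrue ⊢
    obtain ⟨h, hh, hval⟩ := htrue
    obtain ⟨S, hS, hcert⟩ := hg h hh H hH
    exact ⟨S, hS, fun H' hH' hS' => ⟨h, hh, by have := hcert H' hH' hS'; simp_all⟩⟩
  | var i =>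
    simp only [hl, GateLabel.flip, Bool.false_xor] at htrue ⊢
    obtain ⟨S, hS, hcert⟩ := certified_input hy hs ρ A i H hH
    exact ⟨S, hS, fun H' hH' hS' => (hcert H' hH' hS').trans htrue⟩
  | const b =>
    simp only [hl, GateLabel.flip, Bool.false_xor] at htrue ⊢
    exact ⟨∅, by simp, fun _ _ _ => htrue⟩

theorem Circuit.gateDepth_input (C : Circuit L) {g h : Fin C.size} (hh : h ∈ C.inputs g) :
    C.gateDepth h < C.gateDepth g := by
  rw [C.gateDepth_eq g]
  exact Finset.le_sup (f := fun h => C.gateDepth h + 1) hh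

theorem certified_of_gateDepth_eq_zero (C : Circuit L) {y : (U × U → Bool) → Fin L → Bool}
    (hy : ∀ i, ∃ S : Finset U, S.card ≤ 2 ∧ ∀ H H', AgreeOn S H H' → y H' i = y H i)
    {s : ℕ} (hs : 2 ≤ s) (ρ : U × U → Bool) (A : Finset U) (g : Fin C.size)
    (hg : C.gateDepth g = 0) : Certified (fun H => C.value (y H) g) ρ A s := by
  have hempty : C.inputs g = ∅ := Finset.eq_empty_of_forall_notMem fun h hh => by
    have := C.gateDepth_input hh
    omega
  have hconst : ∀ f : (U × U → Bool) → Bool, (∀ H H', f H' = f H) → Certified f ρ A s :=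
    fun f hf H _ => ⟨∅, by simp, fun H' _ _ => hf H H'⟩
  simp only [C.value_eq _ g, hempty]
  cases C.label g with
  | and => exact hconst _ fun _ _ => by simp
  | or => exact hconst _ fun _ _ => by simp
  | not => exact hconst _ fun _ _ => by simp
  | var i => exact certified_input hy hs ρ A i
  | const b => exact hconst _ fun _ _ => rfl

variable [Fintype U] [DecidableEq U]

/-- Induction on the level, with the same `s` throughout. A clique outside the new `A'` splits into
its part outside `A`, bounded by induction, and its part inside `A`, fixed by the new labelling. -/
theorem exists_restriction_depth (C : Circuit L) {y : (U × U → Bool) → Fin L → Bool}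
    (hy : ∀ i, ∃ S : Finset U, S.card ≤ 2 ∧ ∀ H H', AgreeOn S H H' → y H' i = y H i)
    {s r Z P Q : ℕ} (hs : 2 ≤ s) (hP : 2 ≤ P) (hQ : 0 < Q)
    (hZ : ∀ v, s < v → v ≤ 2 * s → P ^ (v * v) * Z ≤ Q ^ v)
    (hM : 4 * Q * (C.size * (2 ^ s * 2 ^ (2 * s * (2 * s))) ^ (s + 1)) < Z)
    (hr : 4 * Q * Fintype.card U ^ r < P ^ (r * r - r)) [Nonempty U] (t : ℕ) :
    ∃ (A : Finset U) (ρ : U × U → Bool), Fintype.card U ≤ (2 * Q) ^ t * A.card ∧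
      (∀ g, C.gateDepth g ≤ t → Certified (fun H => C.value (y H) g) ρ A s) ∧
      ∀ R : Finset U, Disjoint R A → (∀ e ∈ R.offDiag, ρ e = true) → R.card ≤ t * r := by
  induction t with
  | zero =>
    refine ⟨Finset.univ, fun _ => false, by simp, fun g hg => ?_, fun R hR _ => ?_⟩
    · exact certified_of_gateDepth_eq_zero C hy hs _ _ g (Nat.le_zero.1 hg)
    · have : R = ∅ := by
        rwa [← Finset.top_eq_univ, disjoint_top] at hR
      simp [this]
  | succ t ih =>
    obtain ⟨A, ρ, hA, hcert, hcl⟩ := ih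
    have : NeZero Q := ⟨hQ.ne'⟩
    have : NeZero P := ⟨by omega⟩
    have : Nontrivial (Fin P) := Fin.nontrivial_iff_two_le.2 hP
    have hne : A.Nonempty := by
      rw [Finset.nonempty_iff_ne_empty]
      rintro rfl
      have : 0 < Fintype.card U := Fintype.card_pos
      simp at hA
    let ι := {g : Fin C.size // C.gateDepth g ≤ t + 1}
    have hι : Fintype.card ι ≤ C.size := by
      simpa using Fintype.card_subtype_le fun g : Fin C.size => C.gateDepth g ≤ t + 1
    obtain ⟨A', x, hA', hcard, hcert', hcl'⟩ := exists_restriction (α := Fin Q) (β := Fin P)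
      (f := fun g : ι => fun H => xor (C.label g.1).flip (C.value (y H) g.1)) (ρ := ρ) (A := A)
      (s := s) (r := r) (Z := Z) 0 0 hne
      (fun g => certifiedTrue_gate C hy hs g.1 fun h hh => hcert h
        (by have := C.gateDepth_input hh; have := g.2; omega))
      (by simpa using hZ)
      (by
        rw [Fintype.card_fin]
        refine lt_of_le_of_lt ?_ hM
        gcongr)
      (by simpa using hr)
    rw [Fintype.card_fin] at hcard
    refine ⟨A', overwrite A x ρ, ?_, fun g hg => (hcert' ⟨g, hg⟩).of_xor, fun R hR hRcl => ?_⟩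
    · calc Fintype.card U ≤ (2 * Q) ^ t * A.card := hA
        _ ≤ (2 * Q) ^ t * (2 * Q * A'.card) := by gcongr
        _ = _ := by ring
    · have h1 : (R \ A).card ≤ t * r := by
        refine hcl _ Finset.sdiff_disjoint fun e he => ?_
        have heA : e ∉ A ×ˢ A := by
          rw [Finset.mem_offDiag] at he
          rw [Finset.mem_product]
          exact fun h => (Finset.mem_sdiff.1 he.1).2 h.1
        rw [← overwrite_of_notMem heA x ρ]
        exact hRcl e (Finset.offDiag_mono Finset.sdiff_subset he)
      have h2 : (R ∩ A).card < r := by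
        refine hcl' _ fun e he => ?_
        have heA : e ∈ A ×ˢ A := by
          rw [Finset.mem_offDiag] at he
          exact Finset.mem_product.2
            ⟨(Finset.mem_inter.1 he.1).2, (Finset.mem_inter.1 he.2.1).2⟩
        rw [← overwrite_of_mem heA x ρ]
        exact hRcl e (Finset.offDiag_mono Finset.inter_subset_left he)
      have := Finset.card_sdiff_add_card_inter R A
      rw [add_mul]
      omega

/-- A circuit of depth at most `d` does not notice a planted clique. -/
theorem exists_indistinguishable (C : Circuit L) {y : (U × U → Bool) → Fin L → Bool}
    (hy : ∀ i, ∃ S : Finset U, S.card ≤ 2 ∧ ∀ H H', AgreeOn S H H' → y H' i = y H i)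
    {s r Z P Q d k : ℕ} (hs : 2 ≤ s) (hP : 2 ≤ P) (hQ : 0 < Q) (hd : C.depth ≤ d)
    (hZ : ∀ v, s < v → v ≤ 2 * s → P ^ (v * v) * Z ≤ Q ^ v)
    (hM : 4 * Q * (C.size * (2 ^ s * 2 ^ (2 * s * (2 * s))) ^ (s + 1)) < Z)
    (hr : 4 * Q * Fintype.card U ^ r < P ^ (r * r - r))
    (hU : (2 * Q) ^ d * (s + k) ≤ Fintype.card U) :
    ∃ H₀ H₁ : U × U → Bool, C.eval (y H₀) = C.eval (y H₁) ∧
      (∀ R : Finset U, (∀ e ∈ R.offDiag, H₀ e = true) → R.card ≤ d * r + 1) ∧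
      ∃ R : Finset U, R.card = k ∧ ∀ e ∈ R.offDiag, H₁ e = true := by
  have hpos : 0 < (2 * Q) ^ d := by positivity
  have : Nonempty U := Fintype.card_pos_iff.1 (by nlinarith)
  obtain ⟨A, ρ, hA, hcert, hcl⟩ := exists_restriction_depth C hy hs hP hQ hZ hM hr d
  have hAcard : s + k ≤ A.card := Nat.le_of_mul_le_mul_left (hU.trans hA) hpos
  have hout : C.gateDepth C.output ≤ d :=
    (Finset.le_sup (f := C.gateDepth) (Finset.mem_univ _)).trans hd
  let H₀ := overwrite A (fun _ => false) ρ
  obtain ⟨S, hS, hS'⟩ := hcert C.output hout H₀ fun e he => overwrite_of_notMem he _ _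
  have hAS : k ≤ (A \ S).card := by
    have := Finset.le_card_sdiff S A
    omega
  obtain ⟨K, hK, hKcard⟩ := Finset.exists_subset_card_eq hAS
  have hKA : K ⊆ A := hK.trans Finset.sdiff_subset
  refine ⟨H₀, overwrite K (fun _ => true) H₀, (hS' _ (fun e he => ?_) fun e he => ?_).symm,
    fun R hR => ?_, K, hKcard, fun e he => ?_⟩
  · rw [overwrite_of_notMem fun h => he (mem_square_mono hKA h)]
    exact overwrite_of_notMem he _ _
  · refine (overwrite_of_notMem (fun h => ?_) _ _).symm
    exact (Finset.mem_sdiff.1 (hK (Finset.mem_product.1 h).1)).2 (Finset.mem_product.1 he).1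
  · have h1 : (R \ A).card ≤ d * r := by
      refine hcl _ Finset.sdiff_disjoint fun e he => ?_
      have heA : e ∉ A ×ˢ A := by
        rw [Finset.mem_offDiag] at he
        rw [Finset.mem_product]
        exact fun h => (Finset.mem_sdiff.1 he.1).2 h.1
      rw [← overwrite_of_notMem heA (fun _ => false) ρ]
      exact hR e (Finset.offDiag_mono Finset.sdiff_subset he)
    have h2 : (R ∩ A).card ≤ 1 := by
      refine Finset.card_le_one.2 fun a ha b hb => ?_
      by_contra hab
      rw [Finset.mem_inter] at ha hb
      have h3 := hR (a, b) (Finset.mem_offDiag.2 ⟨ha.1, hb.1, hab⟩)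
      have h4 : H₀ (a, b) = false :=
        overwrite_of_mem (Finset.mem_product.2 ⟨ha.2, hb.2⟩) _ _
      rw [h4] at h3
      exact Bool.false_ne_true h3
    have := Finset.card_sdiff_add_card_inter R A
    omega
  · rw [Finset.mem_offDiag] at he
    exact overwrite_of_mem (Finset.mem_product.2 ⟨he.1, he.2.1⟩) _ _

end Circuits

/-! ### Choice of the parameters -/

theorem exists_plantable_clique (c d : ℕ) : ∃ k₀ : ℕ, ∀ F k₁ l : ℕ, ∃ n : ℕ,
    ∀ (L : ℕ) (C : Circuit L) (y : (Fin n × Fin n → Bool) → Fin L → Bool),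
      (∀ i, ∃ S : Finset (Fin n), S.card ≤ 2 ∧ ∀ H H', AgreeOn S H H' → y H' i = y H i) →
      L = l + n * n → C.depth ≤ d → C.size ≤ F * (L + 1) ^ c →
      ∃ H₀ H₁, C.eval (y H₀) = C.eval (y H₁) ∧
        (∀ R : Finset (Fin n), (∀ e ∈ R.offDiag, H₀ e = true) → R.card < k₀) ∧
        ∃ R : Finset (Fin n), R.card = k₁ ∧ ∀ e ∈ R.offDiag, H₁ e = true := by
  -- With `Q = B ^ (4s)` there will be at most `B ^ D` vertices. Since `D` is linear in `s`, the
  -- exponent `2s²` of `Z` beats that of the circuit size once `s` is large against `d` and `c`.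
  obtain ⟨s, hs⟩ : ∃ s, s = 8 * (d + 1) * (c + 1) := ⟨_, rfl⟩
  obtain ⟨D, hD⟩ : ∃ D, D = (4 * s + 1) * d + 1 := ⟨_, rfl⟩
  obtain ⟨r, hr⟩ : ∃ r, r = D + 4 * s + 4 := ⟨_, rfl⟩
  have hs8 : 8 ≤ s := by
    rw [hs, mul_assoc]
    exact Nat.le_mul_of_pos_right _ (by positivity)
  have hexp : 4 * s + (2 * D + 1) * c + 3 < 2 * s * s := by
    have h1 : 2 * s * s = 16 * (s * (d * c)) + 16 * (s * d) + 16 * (s * c) + 16 * s := by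
      conv_lhs => rw [hs]
      rw [hs]; ring
    have h2 : (2 * D + 1) * c = 8 * (s * (d * c)) + 2 * (d * c) + 3 * c := by
      rw [hD]; ring
    have h3 : 8 * (d * c) ≤ s * (d * c) := Nat.mul_le_mul_right _ hs8
    have h4 : 8 * c ≤ s * c := Nat.mul_le_mul_right _ hs8
    omega
  have hrexp : 1 + 4 * s + D * r < r * r - r := by
    have h1 : r * r = D * r + 4 * s * r + 4 * r := by
      conv_lhs => rw [hr]
      rw [hr]; ring
    have h2 : 4 * s * 1 ≤ 4 * s * r := Nat.mul_le_mul_left _ (by omega)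
    omega
  refine ⟨d * r + 2, fun F k₁ l => ?_⟩
  obtain ⟨K, hK⟩ : ∃ K, K = (2 ^ s * 2 ^ (2 * s * (2 * s))) ^ (s + 1) := ⟨_, rfl⟩
  -- Every quantity that is not a power of `B` is absorbed into one factor `B`.
  obtain ⟨B, hB⟩ : ∃ B, B = s + k₁ + F + l + K + 4 := ⟨_, rfl⟩
  have hB1 : 1 < B := by omega
  have hB0 : 0 < B := by omega
  obtain ⟨n, hn⟩ : ∃ n, n = (2 * B ^ (4 * s)) ^ d * B := ⟨_, rfl⟩
  refine ⟨n, fun L C y hy hL hdepth hsize => ?_⟩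
  have hnD : n ≤ B ^ D := by
    calc n ≤ (B * B ^ (4 * s)) ^ d * B := by
          rw [hn]
          gcongr
          omega
      _ = B ^ D := by rw [hD, ← pow_succ', ← pow_mul, pow_succ]
  have hLB : L + 1 ≤ B ^ (2 * D + 1) := by
    have h1 : n * n ≤ B ^ (2 * D) := by
      rw [two_mul, pow_add]
      exact Nat.mul_le_mul hnD hnD
    have h2 : B ≤ B ^ (2 * D) := Nat.le_self_pow (by omega) B
    have h3 : B ^ (2 * D) * 2 ≤ B ^ (2 * D + 1) := by
      rw [pow_succ]
      exact Nat.mul_le_mul_left _ hB1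
    omega
  have hsizeB : C.size ≤ B ^ ((2 * D + 1) * c + 1) := by
    calc C.size ≤ F * (L + 1) ^ c := hsize
      _ ≤ B * (B ^ (2 * D + 1)) ^ c := by
          gcongr
          omega
      _ = _ := by rw [← pow_mul, ← pow_succ']
  obtain ⟨H₀, H₁, heval, h₀, h₁⟩ := exists_indistinguishable C hy (s := s) (r := r)
    (Z := B ^ (2 * s * s)) (P := B) (Q := B ^ (4 * s)) (d := d) (k := k₁) (by omega) hB1
    (by positivity) hdepth
    (fun v hv hv' => by
      rw [← pow_add, ← pow_mul]
      -- For `s < v ≤ 2s` one has `v² + 2s² ≤ 2sv + 2sv = 4sv`.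
      exact Nat.pow_le_pow_right hB0 (by nlinarith))
    (by
      rw [← hK]
      calc 4 * B ^ (4 * s) * (C.size * K)
          ≤ B * B ^ (4 * s) * (B ^ ((2 * D + 1) * c + 1) * B) := by
            gcongr <;> omega
        _ = B ^ (4 * s + (2 * D + 1) * c + 3) := by ring
        _ < B ^ (2 * s * s) := Nat.pow_lt_pow_right hB1 hexp)
    (by
      rw [Fintype.card_fin]
      calc 4 * B ^ (4 * s) * n ^ r ≤ B * B ^ (4 * s) * (B ^ D) ^ r := by
            gcongr
            omega
        _ = B ^ (1 + 4 * s + D * r) := by ring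
        _ < B ^ (r * r - r) := Nat.pow_lt_pow_right hB1 hrexp)
    (by
      rw [Fintype.card_fin, hn]
      gcongr
      omega)
  exact ⟨H₀, H₁, heval, fun R hR => by have := h₀ R hR; omega, h₁⟩

/-! ### Encodings of graphs -/

/-- The graph with an edge between `i` and `j` if `H` holds in both directions. -/
def symmGraph {m : ℕ} (H : Fin m × Fin m → Bool) : SimpleGraph (Fin m) where
  Adj i j := i ≠ j ∧ H (i, j) = true ∧ H (j, i) = true
  symm := ⟨fun _ _ h => ⟨h.1.symm, h.2.2, h.2.1⟩⟩
  loopless := ⟨fun _ h => h.1 rfl⟩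

theorem symmGraph_isClique_iff {m : ℕ} {H : Fin m × Fin m → Bool} {R : Finset (Fin m)} :
    (symmGraph H).IsClique R ↔ ∀ e ∈ R.offDiag, H e = true := by
  constructor
  · intro h e he
    rw [Finset.mem_offDiag] at he
    exact (h he.1 he.2.1 he.2.2).2.1
  · intro h i hi j hj hij
    exact ⟨hij, h (i, j) (Finset.mem_offDiag.2 ⟨hi, hj, hij⟩),
      h (j, i) (Finset.mem_offDiag.2 ⟨hj, hi, hij.symm⟩)⟩

/-- The part of the encoding that precedes the adjacency matrix. -/
def encodePrefix (k : ℕ) : List Bool :=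
  (Nat.bits k).flatMap (fun b => [b, b]) ++ [false, true]

open Classical in
theorem encode_eq {m : ℕ} (G : SimpleGraph (Fin m)) (k : ℕ) :
    encode G k = encodePrefix k ++
      List.ofFn fun p : Fin (m * m) => decide (G.Adj p.divNat p.modNat) := rfl

theorem length_encode {m : ℕ} (G : SimpleGraph (Fin m)) (k : ℕ) :
    (encode G k).length = (encodePrefix k).length + m * m := by
  rw [encode_eq, List.length_append, List.length_ofFn]

/-- Prefix bits are constant, and a matrix bit depends only on the pairs within its two vertices; so
two vertices certify any input bit. -/
theorem getD_encode_local {m : ℕ} (k i : ℕ) :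
    ∃ S : Finset (Fin m), S.card ≤ 2 ∧ ∀ H H' : Fin m × Fin m → Bool, AgreeOn S H H' →
      (encode (symmGraph H') k).getD i false = (encode (symmGraph H) k).getD i false := by
  classical
  simp only [encode_eq, List.getD_eq_getElem?_getD]
  rcases lt_or_ge i (encodePrefix k).length with hi | hi
  · refine ⟨∅, by simp, fun H H' _ => ?_⟩
    rw [List.getElem?_append_left hi, List.getElem?_append_left hi]
  · by_cases hp : i - (encodePrefix k).length < m * m
    · set p : Fin (m * m) := ⟨_, hp⟩ with hpdef
      refine ⟨{p.divNat, p.modNat}, Finset.card_le_two, fun H H' h => ?_⟩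
      rw [List.getElem?_append_right hi, List.getElem?_append_right hi, List.getElem?_ofFn,
        List.getElem?_ofFn, dif_pos hp, dif_pos hp, ← hpdef]
      have hadj : (symmGraph H').Adj p.divNat p.modNat ↔ (symmGraph H).Adj p.divNat p.modNat := by
        simp only [symmGraph]
        rw [h (p.divNat, p.modNat) (by simp), h (p.modNat, p.divNat) (by simp)]
      simp only [hadj]
    · refine ⟨∅, by simp, fun H H' _ => ?_⟩
      rw [List.getElem?_append_right hi, List.getElem?_append_right hi, List.getElem?_ofFn,
        List.getElem?_ofFn, dif_neg hp, dif_neg hp]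

theorem eval_get_of_length_eq (C : CircuitFamily) {x : List Bool} {L k : ℕ} (h : x.length = L) :
    (C x.length k).eval x.get = (C L k).eval fun i => x.getD i false := by
  subst h
  congr 1
  funext i
  simp

/-- Needed for `pClique`, whose language quantifies over all graphs with the given code. -/
theorem encode_injective {m m' : ℕ} {G : SimpleGraph (Fin m)} {G' : SimpleGraph (Fin m')}
    {k k' : ℕ} (h : encode G k = encode G' k') : k = k' ∧ m = m' ∧ G ≍ G' := by
  have hk : k = k' := by rw [← cliqueParam_encode G k, h, cliqueParam_encode]
  subst hk
  have hlen := congrArg List.length h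
  rw [length_encode, length_encode] at hlen
  have hm : m = m' := Nat.mul_self_inj.1 (by omega)
  subst hm
  refine ⟨rfl, rfl, heq_of_eq ?_⟩
  rw [encode_eq, encode_eq] at h
  have h' := List.ofFn_injective (List.append_cancel_left h)
  ext i j
  have hij := congrFun h' (finProdFinEquiv (i, j))
  have e1 : (finProdFinEquiv (i, j)).divNat = i :=
    congrArg Prod.fst (finProdFinEquiv.symm_apply_apply (i, j))
  have e2 : (finProdFinEquiv (i, j)).modNat = j :=
    congrArg Prod.snd (finProdFinEquiv.symm_apply_apply (i, j))
  simpa [e1, e2] using hij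

/-! ### Lower bounds -/

theorem exists_indistinguishable_graphs {C : CircuitFamily} (hC : C.BoundedDepth) {f : ℕ → ℕ}
    (hf : C.SizeBoundedBy f) : ∃ k₀ : ℕ, ∀ k₁ : ℕ, ∃ (n : ℕ) (G₀ G₁ : SimpleGraph (Fin n)),
      G₀.cliqueNum < k₀ ∧ k₁ ≤ G₁.cliqueNum ∧
      (C (encode G₀ k₀).length k₀).eval (encode G₀ k₀).get =
        (C (encode G₁ k₀).length k₀).eval (encode G₁ k₀).get := by
  obtain ⟨d, hd⟩ := hC
  obtain ⟨c, hc⟩ := hf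
  obtain ⟨k₀, hk₀⟩ := exists_plantable_clique c d
  refine ⟨k₀, fun k₁ => ?_⟩
  obtain ⟨n, hn⟩ := hk₀ (f k₀) k₁ (encodePrefix k₀).length
  obtain ⟨H₀, H₁, heval, h₀, R, hR, h₁⟩ := hn _ (C ((encodePrefix k₀).length + n * n) k₀)
    (fun H i => (encode (symmGraph H) k₀).getD i false) (fun i => getD_encode_local k₀ i) rfl
    (hd _ _) (hc _ _)
  refine ⟨n, symmGraph H₀, symmGraph H₁, ?_, ?_, ?_⟩
  · obtain ⟨S, hS⟩ := (symmGraph H₀).exists_isNClique_cliqueNum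
    rw [← hS.card_eq]
    exact h₀ S (symmGraph_isClique_iff.1 hS.isClique)
  · rw [← hR]
    exact SimpleGraph.IsClique.card_le_cliqueNum (tc := symmGraph_isClique_iff.2 h₁)
  · rw [eval_get_of_length_eq C (length_encode (symmGraph H₀) k₀),
      eval_get_of_length_eq C (length_encode (symmGraph H₁) k₀)]
    exact heval

theorem PromiseProblem.InParaAC0.nonuniform {P : PromiseProblem} (h : P.InParaAC0) :
    P.InNonuniformParaAC0 := by
  obtain ⟨C, hd, ⟨f, -, hf⟩, hC, -⟩ := h
  exact ⟨C, hd, ⟨f, hf⟩, hC⟩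

theorem pGapClique_not_inNonuniformParaAC0 {ρ : ℕ → ℝ}
    (hmono : Monotone fun k : ℕ => (k : ℝ) / ρ k)
    (hunb : ¬ BddAbove (Set.range fun k : ℕ => (k : ℝ) / ρ k)) :
    ¬ (pGapClique ρ).InNonuniformParaAC0 := by
  rintro ⟨C, hd, ⟨f, hf⟩, hyes, hno⟩
  obtain ⟨k₀, hk₀⟩ := exists_indistinguishable_graphs hd hf
  -- Unboundedness provides `k₁` with `k₁ / ρ k₁ > k₀`; monotonicity extends this to the actual
  -- clique number, which may exceed `k₁`.
  obtain ⟨_, ⟨k₁, rfl⟩, hk₁⟩ := not_bddAbove_iff.1 hunb k₀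
  obtain ⟨n, G₀, G₁, h₀, h₁, heval⟩ := hk₀ k₁
  have hy := hyes _ ⟨n, G₁, k₀, rfl, hk₁.le.trans (hmono h₁)⟩
  have hn := hno _ ⟨n, G₀, k₀, rfl, h₀⟩
  have e : ∀ G : SimpleGraph (Fin n), (pGapClique ρ).param (encode G k₀) = k₀ :=
    fun G => cliqueParam_encode G k₀
  rw [e] at hy hn
  rw [heval, hy] at hn
  exact Bool.noConfusion hn

theorem IsCostApproximation.gap_inNonuniformParaAC0 {ρ : ℕ → ℝ} {A : Set (List Bool)}
    (hA : IsCostApproximation ρ A) (h : (ParamProblem.mk A cliqueParam).InNonuniformParaAC0) :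
    (pGapClique ρ).InNonuniformParaAC0 := by
  obtain ⟨C, hd, hf, hyes, hno⟩ := h
  refine ⟨C, hd, hf, ?_, ?_⟩
  · rintro _ ⟨m, G, k, rfl, hk⟩
    exact hyes _ ((hA m G k).1 hk)
  · rintro _ ⟨m, G, k, rfl, hk⟩
    exact hno _ ((hA m G k).2 hk)

/-- This reduces exact clique to the gap problem of constant ratio one. -/
theorem isCostApproximation_pClique : IsCostApproximation (fun _ => 1) pClique.language := by
  refine fun m G k => ⟨fun hk => ?_, ?_⟩
  · rw [div_one, Nat.cast_le] at hk
    obtain ⟨S, hS⟩ := G.exists_isNClique_cliqueNum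
    obtain ⟨T, hTS, hT⟩ := Finset.exists_subset_card_eq (hk.trans_eq hS.card_eq.symm)
    exact ⟨m, G, k, rfl, T, hS.isClique.subset hTS, hT⟩
  · rintro hk ⟨m', G', k', h, S, hS⟩
    obtain ⟨rfl, rfl, hG⟩ := encode_injective h
    obtain rfl := eq_of_heq hG
    have := hS.isClique.card_le_cliqueNum
    rw [hS.card_eq] at this
    omega

theorem pClique_not_inNonuniformParaAC0 : ¬ pClique.InNonuniformParaAC0 := by
  refine fun h => pGapClique_not_inNonuniformParaAC0 (ρ := fun _ => 1) ?_ ?_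
    (isCostApproximation_pClique.gap_inNonuniformParaAC0 h)
  · simpa only [div_one] using Nat.mono_cast
  · simp only [div_one]
    refine not_bddAbove_iff.2 fun x => ?_
    obtain ⟨k, hk⟩ := exists_nat_gt x
    exact ⟨k, ⟨k, rfl⟩, hk⟩

end ParaAC

theorem mainTheorem1 :
    (∀ ρ : ℕ → ℝ, ParaAC.ComputableRealFun ρ → (∀ k, 1 ≤ ρ k) →
      Monotone (fun k : ℕ => (k : ℝ) / ρ k) →
      ¬ BddAbove (Set.range fun k : ℕ => (k : ℝ) / ρ k) →
        ¬ (ParaAC.pGapClique ρ).InParaAC0 ∧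
        (¬ ∃ A : Set (List Bool), ParaAC.IsCostApproximation ρ A ∧
          (ParaAC.ParamProblem.mk A ParaAC.cliqueParam).InParaAC0) ∧
        ¬ (ParaAC.pGapClique ρ).InNonuniformParaAC0 ∧
        (¬ ∃ A : Set (List Bool), ParaAC.IsCostApproximation ρ A ∧
          (ParaAC.ParamProblem.mk A ParaAC.cliqueParam).InNonuniformParaAC0)) ∧
    ¬ ParaAC.pClique.InParaAC0 ∧
    ¬ ParaAC.pClique.InNonuniformParaAC0 := by
  refine ⟨fun ρ _ _ hmono hunb => ?_, fun h => ParaAC.pClique_not_inNonuniformParaAC0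
    (ParaAC.PromiseProblem.InParaAC0.nonuniform h), ParaAC.pClique_not_inNonuniformParaAC0⟩
  have h := ParaAC.pGapClique_not_inNonuniformParaAC0 hmono hunb
  exact ⟨fun h' => h h'.nonuniform,
    fun ⟨_, hA, h'⟩ => h (hA.gap_inNonuniformParaAC0
      (ParaAC.PromiseProblem.InParaAC0.nonuniform h')),
    h, fun ⟨_, hA, h'⟩ => h (hA.gap_inNonuniformParaAC0 h')⟩
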